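/- A pseudoline is the image of a straight line under a homeomorphism of the Euclidean plane. A simple arrangement of $n\ge 3$ pseudolines is a collection of $n$ pseudolines in the plane such that any two of them meet in exactly one point, where they cross each other, and no three of them have a common point. Its pseudoline arrangement graph has as vertices the intersection points of the pseudolines; two vertices are adjacent if they lie on a common pseudoline with no other vertex on the part of this pseudoline between them. An end vertex of a pseudoline $l$ is a vertex on $l$ that does not lie strictly between two other vertices on $l$. Let $G$ be the pseudoline arrangement graph of a simple arrangement of $n\ge 3$ pseudolines. Then $G$ is connected and its diameter is exactly $n-2$. Moreover: (a) every shortest path of length $k$ in $G$ has vertices on exactly $k+2$ distinct pseudolines; (b) for any two vertices $u,v$ on a common pseudoline $l$, there is a unique shortest $u,v$-path in $G$, and all its vertices lie on $l$; (c) every pseudoline has exactly two end vertices, and their distance in $G$ is $n-2$. -/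

import Mathlib

open Topology

/-- The points `x` and `y` of `F` lie in different connected components of `F`. -/
def SeparatedIn {X : Type*} [TopologicalSpace X] (F : Set X) (x y : X) : Prop :=
  x ∈ F ∧ y ∈ F ∧ connectedComponentIn F x ≠ connectedComponentIn F y

theorem SeparatedIn.symm {X : Type*} [TopologicalSpace X] {F : Set X} {x y : X}
    (h : SeparatedIn F x y) : SeparatedIn F y x :=
  ⟨h.2.1, h.1, fun e => h.2.2 e.symm⟩

/-- A pseudoline in the plane `ℝ × ℝ`: the image of a line (without loss of generality the
first coordinate axis) under a homeomorphism of the plane. -/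
def IsPseudoline (l : Set (ℝ × ℝ)) : Prop :=
  ∃ h : (ℝ × ℝ) ≃ₜ (ℝ × ℝ), h '' {x | x.2 = 0} = l

/-- The curve `l'` crosses the pseudoline `l` at the point `p`: arbitrarily near to the common
point `p`, the curve `l'` has points on both sides of `l` (the sides of `l` are the connected
components of its complement). -/
def CrossesAt (l l' : Set (ℝ × ℝ)) (p : ℝ × ℝ) : Prop :=
  p ∈ l ∧ p ∈ l' ∧ ∀ U ∈ 𝓝 p, ∃ x ∈ l' ∩ U, ∃ y ∈ l' ∩ U, SeparatedIn lᶜ x y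

/-- The point `w` of the pseudoline `l` lies strictly between the points `u` and `v` of `l`:
removing `w` from `l` separates `u` from `v` on `l`. -/
def StrictlyBetween (l : Set (ℝ × ℝ)) (u w v : ℝ × ℝ) : Prop :=
  w ∈ l ∧ SeparatedIn (l \ {w}) u v

/-- A simple arrangement of `n ≥ 3` pseudolines in the plane: any two of them meet in exactly one
point, where they cross each other, and no three of them have a common point. -/
structure SimplePseudolineArrangement (n : ℕ) where
  line : Fin n → Set (ℝ × ℝ)
  three_le : 3 ≤ n
  isPseudoline : ∀ i, IsPseudoline (line i)
  crossing : ∀ i j, i ≠ j → ∃ p, line i ∩ line j = {p} ∧ CrossesAt (line i) (line j) p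
  simple : ∀ i j k, i ≠ j → i ≠ k → j ≠ k → line i ∩ line j ∩ line k = ∅

namespace SimplePseudolineArrangement

/-- The vertices of the arrangement: the intersection points of two different pseudolines. -/
def Vertex {n : ℕ} (A : SimplePseudolineArrangement n) : Type :=
  {p : ℝ × ℝ // ∃ i j, i ≠ j ∧ p ∈ A.line i ∧ p ∈ A.line j}

/-- The vertex `u` lies on the `i`-th pseudoline. -/
def On {n : ℕ} (A : SimplePseudolineArrangement n) (u : A.Vertex) (i : Fin n) : Prop :=
  u.1 ∈ A.line i

/-- The pseudoline arrangement graph: two vertices are adjacent if they lie on a common pseudoline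
with no other vertex in the part of this pseudoline between them. -/
def graph {n : ℕ} (A : SimplePseudolineArrangement n) : SimpleGraph A.Vertex where
  Adj u v := u ≠ v ∧ ∃ i, A.On u i ∧ A.On v i ∧
    ∀ w : A.Vertex, ¬ StrictlyBetween (A.line i) u.1 w.1 v.1
  symm := ⟨fun _ _ h => ⟨h.1.symm, h.2.choose, h.2.choose_spec.2.1, h.2.choose_spec.1,
    fun w hw => h.2.choose_spec.2.2 w ⟨hw.1, hw.2.symm⟩⟩⟩
  loopless := ⟨fun _ h => h.1 rfl⟩

/-- An end vertex of the `i`-th pseudoline: a vertex on it that does not lie strictly between two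
other vertices on it. -/
def IsEndVertex {n : ℕ} (A : SimplePseudolineArrangement n) (i : Fin n) (u : A.Vertex) : Prop :=
  A.On u i ∧ ∀ x y : A.Vertex, A.On x i → A.On y i →
    ¬ StrictlyBetween (A.line i) x.1 u.1 y.1

/-- A shortest path of the arrangement graph. -/
def IsShortestPath {n : ℕ} (A : SimplePseudolineArrangement n) {u v : A.Vertex}
    (p : A.graph.Walk u v) : Prop :=
  p.IsPath ∧ p.length = A.graph.dist u v

end SimplePseudolineArrangement

/-!
The topology enters only through two facts. Each pseudoline is a line in a coordinate `c` (a
homeomorphism to `ℝ`), and "strictly between" on it is betweenness of coordinates. If `l` meets `l'`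
in the single point `p` and crosses there, then points of `l` on different sides of `p` lie in
different components of the complement of `l'` (`IsLineCoordinate.separated`). On the other hand, an
edge of the graph whose ends avoid `l'` is an arc avoiding `l'`. Hence a walk between two
vertices that are separated by a pseudoline visits a vertex of this pseudoline
(`mem_linesOf_of_separated`).

Let `linesOf p` be the set of pseudolines visited by a walk `p`. Each step stays on a pseudoline and
leads to at most one new pseudoline, so `linesOf p` has at most `p.length + 2` elements. If `u` and
`v` lie on `l` with `m` vertices strictly between them, then every walk from `u` to `v` visits `l`,
the second pseudolines through `u` and `v`, and the `m` pseudolines that cross `l` between them.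
So the walk has length at least `m + 1`, and walking along `l` attains this (`dist_eq`). If a
shortest walk left `u` along a pseudoline different from `l`, then its first step would not change
`linesOf`, and the count would be violated; so all shortest walks from `u` to `v` follow `l`
(`on_of_shortest_cons`), and they coincide (`shortest_unique`).

For an arbitrary shortest path, if a step did not add a new pseudoline, the path would contain a
shortest path between two vertices of a pseudoline that leaves this pseudoline. Hence the number of
visited pseudolines is exactly the length plus two (`ncard_linesOf_of_shortest`). As it is at
most `n`, all distances are at most `n - 2`; the end vertices of a pseudoline attain this.
-/

/-! ### Coordinates on a pseudoline -/

/-- The function `c` on the plane restricts to a homeomorphism from `l` to `ℝ`, whose inverse is a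
continuous parametrization of `l`. -/
structure IsLineCoordinate (l : Set (ℝ × ℝ)) (c : ℝ × ℝ → ℝ) : Prop where
  continuous : Continuous c
  exists_param : ∃ γ : ℝ → ℝ × ℝ, Continuous γ ∧ (∀ t, γ t ∈ l) ∧ (∀ t, c (γ t) = t) ∧
    ∀ p ∈ l, γ (c p) = p

theorem IsPseudoline.exists_coordinate {l : Set (ℝ × ℝ)} (h : IsPseudoline l) :
    ∃ c, IsLineCoordinate l c := by
  obtain ⟨f, rfl⟩ := h
  refine ⟨fun p => (f.symm p).1, by fun_prop, fun t => f (t, 0), by fun_prop, fun t => ?_,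
    fun t => by simp, ?_⟩
  · exact ⟨(t, 0), rfl, rfl⟩
  · rintro _ ⟨⟨a, b⟩, hb, rfl⟩
    have hb' : b = 0 := hb
    simp [hb']

namespace IsLineCoordinate

variable {l : Set (ℝ × ℝ)} {c : ℝ × ℝ → ℝ}

theorem neg (h : IsLineCoordinate l c) : IsLineCoordinate l (fun p => -c p) := by
  obtain ⟨γ, hγ, hl, hc, hp⟩ := h.exists_param
  exact ⟨h.continuous.neg, fun t => γ (-t), by fun_prop, fun t => hl _, fun t => by simp [hc],
    fun p hpl => by simp [hp p hpl]⟩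

theorem injOn (h : IsLineCoordinate l c) {x y : ℝ × ℝ} (hx : x ∈ l) (hy : y ∈ l)
    (e : c x = c y) : x = y := by
  obtain ⟨γ, -, -, -, hp⟩ := h.exists_param
  rw [← hp x hx, ← hp y hy, e]

/-- Two points of `l` whose coordinates lie in an interval `S` are in the same component of every
set that contains the arc of `l` over `S`. -/
theorem component_eq (h : IsLineCoordinate l c) {S : Set ℝ} (hS : S.OrdConnected)
    {F : Set (ℝ × ℝ)} (hF : ∀ p ∈ l, c p ∈ S → p ∈ F) {x y : ℝ × ℝ} (hx : x ∈ l) (hy : y ∈ l)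
    (hxS : c x ∈ S) (hyS : c y ∈ S) :
    connectedComponentIn F x = connectedComponentIn F y := by
  obtain ⟨γ, hγ, hl, hc, hp⟩ := h.exists_param
  have hpre : IsPreconnected (γ '' S) := hS.isPreconnected.image γ hγ.continuousOn
  have hsub : γ '' S ⊆ F := by
    rintro _ ⟨t, ht, rfl⟩
    exact hF _ (hl t) (by rwa [hc])
  have hy' : y ∈ connectedComponentIn F x :=
    hpre.subset_connectedComponentIn ⟨c x, hxS, hp x hx⟩ hsub ⟨c y, hyS, hp y hy⟩
  exact connectedComponentIn_eq hy'

theorem strictlyBetween_iff (h : IsLineCoordinate l c) {u w v : ℝ × ℝ} :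
    StrictlyBetween l u w v ↔ u ∈ l ∧ w ∈ l ∧ v ∈ l ∧
      (c u < c w ∧ c w < c v ∨ c v < c w ∧ c w < c u) := by
  constructor
  · rintro ⟨hw, ⟨hu, huw⟩, ⟨hv, hvw⟩, hne⟩
    refine ⟨hu, hw, hv, ?_⟩
    have h1 : c u ≠ c w := fun e => huw (h.injOn hu hw e)
    have h2 : c v ≠ c w := fun e => hvw (h.injOn hv hw e)
    rcases lt_or_gt_of_ne h1 with h1 | h1 <;> rcases lt_or_gt_of_ne h2 with h2 | h2
    · refine absurd (h.component_eq (S := Set.Iio (c w)) Set.ordConnected_Iio ?_ hu hv h1 h2) hne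
      exact fun p hp hpS => ⟨hp, by rintro rfl; exact (lt_irrefl _ : ¬ c p < c p) hpS⟩
    · exact Or.inl ⟨h1, h2⟩
    · exact Or.inr ⟨h2, h1⟩
    · refine absurd (h.component_eq (S := Set.Ioi (c w)) Set.ordConnected_Ioi ?_ hu hv h1 h2) hne
      exact fun p hp hpS => ⟨hp, by rintro rfl; exact (lt_irrefl _ : ¬ c p < c p) hpS⟩
  · rintro ⟨hu, hw, hv, hb⟩
    have huF : u ∈ l \ {w} := ⟨hu, by rintro rfl; rcases hb with hb | hb <;> linarith⟩
    have hvF : v ∈ l \ {w} := ⟨hv, by rintro rfl; rcases hb with hb | hb <;> linarith⟩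
    refine ⟨hw, huF, hvF, fun e => ?_⟩
    have hpre : (c '' connectedComponentIn (l \ {w}) u).OrdConnected :=
      (isPreconnected_connectedComponentIn.image c h.continuous.continuousOn).ordConnected
    have hu' : c u ∈ c '' connectedComponentIn (l \ {w}) u :=
      ⟨u, mem_connectedComponentIn huF, rfl⟩
    have hv' : c v ∈ c '' connectedComponentIn (l \ {w}) u :=
      ⟨v, e ▸ mem_connectedComponentIn hvF, rfl⟩
    have hw' : c w ∈ c '' connectedComponentIn (l \ {w}) u := by
      rcases hb with hb | hb
      · exact hpre.out hu' hv' ⟨hb.1.le, hb.2.le⟩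
      · exact hpre.out hv' hu' ⟨hb.1.le, hb.2.le⟩
    obtain ⟨x, hx, hxw⟩ := hw'
    have hxF := connectedComponentIn_subset _ _ hx
    exact hxF.2 (h.injOn hxF.1 hw hxw)

/-- If `l` crosses `l'` in their only common point `p`, then `l'` separates the two rays into which
`p` divides `l`: each ray stays in one component, and if both stayed in the same one, `l` would
reach only one side of `l'`. -/
theorem separated (h : IsLineCoordinate l c) {l' : Set (ℝ × ℝ)} {p : ℝ × ℝ}
    (hp : l' ∩ l = {p}) (hcross : CrossesAt l' l p) {u v : ℝ × ℝ} (hu : u ∈ l) (hv : v ∈ l)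
    (hup : c u < c p) (hpv : c p < c v) :
    connectedComponentIn l'ᶜ u ≠ connectedComponentIn l'ᶜ v := by
  intro e
  have hmem : ∀ x ∈ l, c x ≠ c p → x ∈ l'ᶜ := by
    intro x hx hxp hx'
    have : x ∈ ({p} : Set (ℝ × ℝ)) := hp ▸ ⟨hx', hx⟩
    exact hxp (by rw [Set.mem_singleton_iff.mp this])
  have hcomp : ∀ x ∈ l, x ∈ l'ᶜ → connectedComponentIn l'ᶜ x = connectedComponentIn l'ᶜ u := by
    intro x hx hx'
    have hne : c x ≠ c p := fun hxp => hx' (h.injOn hx hcross.2.1 hxp ▸ hcross.1)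
    rcases lt_or_gt_of_ne hne with hlt | hgt
    · exact h.component_eq (S := Set.Iio (c p)) Set.ordConnected_Iio
        (fun q hq hqS => hmem q hq (ne_of_lt hqS)) hx hu hlt hup
    · rw [e]
      exact h.component_eq (S := Set.Ioi (c p)) Set.ordConnected_Ioi
        (fun q hq hqS => hmem q hq (ne_of_gt hqS)) hx hv hgt hpv
  obtain ⟨x, hx, y, hy, hxF, hyF, hxy⟩ := hcross.2.2 Set.univ Filter.univ_mem
  exact hxy ((hcomp x hx.1 hxF).trans (hcomp y hy.1 hyF).symm)

end IsLineCoordinate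

namespace SimplePseudolineArrangement

variable {n : ℕ} {A : SimplePseudolineArrangement n}

/-! ### Incidence of vertices and pseudolines -/

theorem eq_of_on {i j : Fin n} (hij : i ≠ j) {u v : A.Vertex} (hui : A.On u i) (huj : A.On u j)
    (hvi : A.On v i) (hvj : A.On v j) : u = v := by
  obtain ⟨p, hp, -⟩ := A.crossing i j hij
  have h1 : u.1 ∈ ({p} : Set (ℝ × ℝ)) := hp ▸ ⟨hui, huj⟩
  have h2 : v.1 ∈ ({p} : Set (ℝ × ℝ)) := hp ▸ ⟨hvi, hvj⟩
  exact Subtype.ext (h1.trans h2.symm)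

theorem exists_vertex {i j : Fin n} (hij : i ≠ j) : ∃ u : A.Vertex, A.On u i ∧ A.On u j := by
  obtain ⟨p, hp, hc⟩ := A.crossing i j hij
  exact ⟨⟨p, i, j, hij, hc.1, hc.2.1⟩, hc.1, hc.2.1⟩

theorem exists_other {u : A.Vertex} {i : Fin n} (hu : A.On u i) :
    ∃ j, j ≠ i ∧ A.On u j ∧ ∀ k, A.On u k ↔ k = i ∨ k = j := by
  have key : ∃ j, j ≠ i ∧ A.On u j := by
    obtain ⟨a, b, hab, ha, hb⟩ := u.2
    by_cases h : a = i
    · exact ⟨b, fun e => hab (h.trans e.symm), hb⟩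
    · exact ⟨a, h, ha⟩
  obtain ⟨j, hji, hj⟩ := key
  refine ⟨j, hji, hj, fun k => ⟨fun hk => ?_, by rintro (rfl | rfl) <;> assumption⟩⟩
  by_contra! hne
  have hmem : u.1 ∈ A.line i ∩ A.line j ∩ A.line k := ⟨⟨hu, hj⟩, hk⟩
  rw [A.simple i j k hji.symm hne.1.symm hne.2.symm] at hmem
  exact hmem

theorem exists_on (u : A.Vertex) : ∃ i, A.On u i :=
  let ⟨i, _, _, h, _⟩ := u.2
  ⟨i, h⟩

instance : Finite A.Vertex := by
  refine Finite.of_injective (fun u : A.Vertex => {i | A.On u i}) fun u v h => ?_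
  obtain ⟨i, j, hij, hi, hj⟩ := u.2
  have h' : ∀ k, A.On u k ↔ A.On v k := fun k => Set.ext_iff.mp h k
  exact eq_of_on hij hi hj ((h' i).mp hi) ((h' j).mp hj)

theorem not_between_of_adj {u v : A.Vertex} (h : A.graph.Adj u v) {i : Fin n} (hu : A.On u i)
    (hv : A.On v i) (w : A.Vertex) : ¬ StrictlyBetween (A.line i) u.1 w.1 v.1 := by
  obtain ⟨hne, j, huj, hvj, hj⟩ := h
  by_cases hij : i = j
  · exact hij ▸ hj w
  · exact absurd (eq_of_on hij hu huj hv hvj) hne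

/-! ### The pseudolines visited by a walk -/

/-- The set of (indices of) pseudolines that contain a vertex of the walk `p`. -/
def linesOf {u v : A.Vertex} (p : A.graph.Walk u v) : Set (Fin n) :=
  {i | ∃ w ∈ p.support, A.On w i}

theorem ncard_linesOf_nil (u : A.Vertex) :
    (linesOf (SimpleGraph.Walk.nil : A.graph.Walk u u)).ncard = 2 := by
  obtain ⟨i, hi⟩ := exists_on u
  obtain ⟨j, hji, -, hj⟩ := exists_other hi
  have : linesOf (SimpleGraph.Walk.nil : A.graph.Walk u u) = {i, j} := by
    ext k
    simp [linesOf, hj]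
  rw [this, Set.ncard_pair hji.symm]

theorem on_start_mem_linesOf {u v : A.Vertex} (p : A.graph.Walk u v) {i : Fin n}
    (h : A.On u i) : i ∈ linesOf p := ⟨u, p.start_mem_support, h⟩

theorem on_end_mem_linesOf {u v : A.Vertex} (p : A.graph.Walk u v) {i : Fin n}
    (h : A.On v i) : i ∈ linesOf p := ⟨v, p.end_mem_support, h⟩

theorem linesOf_cons {u w v : A.Vertex} (h : A.graph.Adj u w) (p : A.graph.Walk w v)
    {j k : Fin n} (hw : A.On w j) (hu : ∀ i, A.On u i ↔ i = j ∨ i = k) :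
    linesOf (SimpleGraph.Walk.cons h p) = insert k (linesOf p) := by
  ext i
  have hj := on_start_mem_linesOf p hw
  simp only [linesOf, SimpleGraph.Walk.support_cons, List.mem_cons, exists_eq_or_imp, hu,
    Set.mem_insert_iff, Set.mem_ofPred_eq] at hj ⊢
  constructor
  · rintro ((rfl | rfl) | hi)
    · exact Or.inr hj
    · exact Or.inl rfl
    · exact Or.inr hi
  · rintro (rfl | hi)
    · exact Or.inl (Or.inr rfl)
    · exact Or.inr hi

theorem ncard_linesOf_le {u v : A.Vertex} (p : A.graph.Walk u v) :
    (linesOf p).ncard ≤ p.length + 2 := by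
  induction p with
  | nil => exact (ncard_linesOf_nil _).le
  | cons h p ih =>
    obtain ⟨-, j, huj, hwj, -⟩ := id h
    obtain ⟨k, -, -, hk⟩ := exists_other huj
    rw [linesOf_cons h p hwj hk, SimpleGraph.Walk.length_cons]
    exact (Set.ncard_insert_le _ _).trans (by omega)

theorem component_eq_of_adj {u w : A.Vertex} (h : A.graph.Adj u w) {j : Fin n}
    (hu : ¬ A.On u j) (hw : ¬ A.On w j) :
    connectedComponentIn (A.line j)ᶜ u.1 = connectedComponentIn (A.line j)ᶜ w.1 := by
  obtain ⟨-, i, hui, hwi, hb⟩ := h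
  obtain ⟨c, hc⟩ := (A.isPseudoline i).exists_coordinate
  have hij : i ≠ j := fun e => hu (e ▸ hui)
  refine hc.component_eq (S := Set.uIcc (c u.1) (c w.1)) Set.ordConnected_uIcc ?_ hui hwi
    Set.left_mem_uIcc Set.right_mem_uIcc
  intro p hp hpS hpj
  have hpu : c p ≠ c u.1 := fun e => hu (by
    rw [hc.injOn hp hui e] at hpj
    exact hpj)
  have hpw : c p ≠ c w.1 := fun e => hw (by
    rw [hc.injOn hp hwi e] at hpj
    exact hpj)
  refine hb ⟨p, i, j, hij, hp, hpj⟩ (hc.strictlyBetween_iff.mpr ⟨hui, hp, hwi, ?_⟩)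
  rcases Set.mem_uIcc.mp hpS with hS | hS
  · exact Or.inl ⟨lt_of_le_of_ne hS.1 hpu.symm, lt_of_le_of_ne hS.2 hpw⟩
  · exact Or.inr ⟨lt_of_le_of_ne hS.1 hpw.symm, lt_of_le_of_ne hS.2 hpu⟩

/-- A walk between two vertices on different sides of a pseudoline visits this pseudoline. -/
theorem mem_linesOf_of_separated {u v : A.Vertex} (p : A.graph.Walk u v) {j : Fin n}
    (h : connectedComponentIn (A.line j)ᶜ u.1 ≠ connectedComponentIn (A.line j)ᶜ v.1) :
    j ∈ linesOf p := by
  by_contra hj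
  apply h
  induction p with
  | nil => rfl
  | cons hadj p ih =>
    have hp : j ∉ linesOf p := fun ⟨x, hx, hxj⟩ =>
      hj ⟨x, by simp [hx], hxj⟩
    have hu := fun hu => hj (on_start_mem_linesOf (.cons hadj p) hu)
    have hw := fun hw => hp (on_start_mem_linesOf p hw)
    rw [component_eq_of_adj hadj hu hw]
    by_contra hne
    exact hne (ih hne hp)

/-! ### Distances along a pseudoline -/

/-- The pseudolines that meet the `i`-th one strictly between the vertices `u` and `v` of it, where
`c` is a coordinate on the `i`-th pseudoline; meant for `c u < c v` (otherwise it is empty). -/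
def between (A : SimplePseudolineArrangement n) (i : Fin n) (c : ℝ × ℝ → ℝ) (u v : A.Vertex) :
    Set (Fin n) :=
  {j | j ≠ i ∧ ∃ w : A.Vertex, A.On w i ∧ A.On w j ∧ c u.1 < c w.1 ∧ c w.1 < c v.1}

section Coordinate

variable {i : Fin n} {c : ℝ × ℝ → ℝ}

theorem mem_between_iff {u v w : A.Vertex} {j : Fin n} (hj : j ≠ i) (hwi : A.On w i)
    (hwj : A.On w j) : j ∈ A.between i c u v ↔ c u.1 < c w.1 ∧ c w.1 < c v.1 := by
  constructor
  · rintro ⟨-, x, hxi, hxj, h⟩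
    rwa [eq_of_on hj.symm hxi hxj hwi hwj] at h
  · exact fun h => ⟨hj, w, hwi, hwj, h⟩

theorem between_subset_linesOf (hc : IsLineCoordinate (A.line i) c) {u v : A.Vertex}
    (hu : A.On u i) (hv : A.On v i) (p : A.graph.Walk u v) :
    A.between i c u v ⊆ linesOf p := by
  rintro j ⟨hj, w, hwi, hwj, h1, h2⟩
  obtain ⟨q, hq, hcr⟩ := A.crossing j i hj
  have hwq : w.1 ∈ ({q} : Set (ℝ × ℝ)) := hq ▸ ⟨hwj, hwi⟩
  rw [Set.mem_singleton_iff] at hwq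
  rw [hwq] at h1 h2
  exact mem_linesOf_of_separated p (hc.separated hq hcr hu hv h1 h2)

/-- A walk from `u` to `v` visits the pseudolines that separate them, their common
pseudoline, and the second pseudolines through `u` and through `v`. -/
theorem ncard_between_add_three_le (hc : IsLineCoordinate (A.line i) c) {u v : A.Vertex}
    (hu : A.On u i) (hv : A.On v i) (huv : c u.1 < c v.1) (p : A.graph.Walk u v) :
    (A.between i c u v).ncard + 3 ≤ (linesOf p).ncard := by
  obtain ⟨a, hai, hua, -⟩ := exists_other hu
  obtain ⟨b, hbi, hvb, -⟩ := exists_other hv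
  have hb : b ∉ A.between i c u v := by
    rw [mem_between_iff hbi hv hvb]; simp
  have hab : a ∉ insert b (A.between i c u v) := by
    rw [Set.mem_insert_iff, mem_between_iff hai hu hua]
    rintro (rfl | h)
    · rw [eq_of_on hai hua hu hvb hv] at huv
      exact lt_irrefl _ huv
    · exact lt_irrefl _ h.1
  have hi : i ∉ insert a (insert b (A.between i c u v)) := by
    simp only [Set.mem_insert_iff, not_or]
    exact ⟨hai.symm, hbi.symm, fun h => h.1 rfl⟩
  have hcard : (insert i (insert a (insert b (A.between i c u v)))).ncard =
      (A.between i c u v).ncard + 3 := by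
    rw [Set.ncard_insert_of_notMem hi, Set.ncard_insert_of_notMem hab,
      Set.ncard_insert_of_notMem hb]
  rw [← hcard]
  refine Set.ncard_le_ncard ?_
  refine Set.insert_subset (on_start_mem_linesOf p hu) (Set.insert_subset
    (on_start_mem_linesOf p hua) (Set.insert_subset (on_end_mem_linesOf p hvb)
    (between_subset_linesOf hc hu hv p)))

/-- The walk along the `i`-th pseudoline from `u` to `v`. -/
theorem exists_walk_on (hc : IsLineCoordinate (A.line i) c) {u v : A.Vertex}
    (hu : A.On u i) (hv : A.On v i) (huv : c u.1 < c v.1) :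
    ∃ p : A.graph.Walk u v, (∀ w ∈ p.support, A.On w i) ∧
      p.length ≤ (A.between i c u v).ncard + 1 := by
  induction hm : (A.between i c u v).ncard using Nat.strong_induction_on generalizing u with
  | _ m ih =>
  by_cases hex : ∃ x : A.Vertex, A.On x i ∧ c u.1 < c x.1 ∧ c x.1 < c v.1
  · -- Step to the vertex next to `u` in the direction of `v`.
    obtain ⟨w, ⟨hw, huw, hwv⟩, hmin⟩ := Set.exists_min_image
      {x : A.Vertex | A.On x i ∧ c u.1 < c x.1 ∧ c x.1 < c v.1} (fun x => c x.1)
      (Set.toFinite _) hex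
    have hadj : A.graph.Adj u w := by
      refine ⟨by rintro rfl; exact lt_irrefl _ huw, i, hu, hw, fun x hx => ?_⟩
      obtain ⟨-, hxi, -, h⟩ := hc.strictlyBetween_iff.mp hx
      rcases h with h | h
      · exact absurd (hmin x ⟨hxi, h.1, h.2.trans hwv⟩) (not_le.mpr h.2)
      · linarith
    obtain ⟨k, hki, hwk, -⟩ := exists_other hw
    have hlt : (A.between i c w v).ncard < (A.between i c u v).ncard := by
      refine Set.ncard_lt_ncard (Set.ssubset_iff_exists.mpr ⟨?_, k, ?_, ?_⟩)
      · rintro j ⟨hj, x, hxi, hxj, h1, h2⟩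
        exact ⟨hj, x, hxi, hxj, huw.trans h1, h2⟩
      · exact ⟨hki, w, hw, hwk, huw, hwv⟩
      · rw [mem_between_iff hki hw hwk]; simp
    obtain ⟨p, hp, hlen⟩ := ih _ (hm ▸ hlt) hw hwv rfl
    refine ⟨.cons hadj p, ?_, ?_⟩
    · simpa [hu] using hp
    · rw [SimpleGraph.Walk.length_cons]; omega
  · have hadj : A.graph.Adj u v := by
      refine ⟨by rintro rfl; exact lt_irrefl _ huv, i, hu, hv, fun x hx => ?_⟩
      obtain ⟨-, hxi, -, h⟩ := hc.strictlyBetween_iff.mp hx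
      rcases h with h | h
      · exact hex ⟨x, hxi, h⟩
      · linarith
    refine ⟨.cons hadj .nil, ?_, by simp⟩
    simp [hu, hv]

theorem dist_eq (hc : IsLineCoordinate (A.line i) c) {u v : A.Vertex}
    (hu : A.On u i) (hv : A.On v i) (huv : c u.1 < c v.1) :
    A.graph.dist u v = (A.between i c u v).ncard + 1 := by
  obtain ⟨p, -, hp⟩ := exists_walk_on hc hu hv huv
  obtain ⟨q, hq⟩ := p.reachable.exists_walk_length_eq_dist
  have h1 := ncard_between_add_three_le hc hu hv huv q
  have h2 := ncard_linesOf_le q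
  have h3 := A.graph.dist_le p
  omega

/-- All shortest walks from `u` to `v` begin with the same step if they begin with a step along the
`i`-th pseudoline: this step goes to the neighbour of `u` in the direction of `v`. -/
theorem first_step_unique (hc : IsLineCoordinate (A.line i) c) {u v w x : A.Vertex}
    (hu : A.On u i) (hv : A.On v i) (huv : c u.1 < c v.1) (hw : A.On w i) (hx : A.On x i)
    (huw : A.graph.Adj u w) (hux : A.graph.Adj u x)
    (hdw : A.graph.dist w v < A.graph.dist u v) (hdx : A.graph.dist x v < A.graph.dist u v) :
    w = x := by
  have key : ∀ y : A.Vertex, A.On y i → A.graph.Adj u y →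
      A.graph.dist y v < A.graph.dist u v → c u.1 < c y.1 := by
    intro y hy huy hd
    by_contra! hle
    have hlt : c y.1 < c u.1 := lt_of_le_of_ne hle fun e =>
      huy.1 (Subtype.ext (hc.injOn hu hy e.symm))
    rw [dist_eq hc hu hv huv, dist_eq hc hy hv (hlt.trans huv)] at hd
    have : (A.between i c u v).ncard ≤ (A.between i c y v).ncard := by
      refine Set.ncard_le_ncard ?_
      rintro j ⟨hj, z, hzi, hzj, h1, h2⟩
      exact ⟨hj, z, hzi, hzj, hlt.trans h1, h2⟩
    omega
  have hw' := key w hw huw hdw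
  have hx' := key x hx hux hdx
  rcases lt_trichotomy (c w.1) (c x.1) with h | h | h
  · exact absurd (hc.strictlyBetween_iff.mpr ⟨hu, hw, hx, Or.inl ⟨hw', h⟩⟩)
      (not_between_of_adj hux hu hx w)
  · exact Subtype.ext (hc.injOn hw hx h)
  · exact absurd (hc.strictlyBetween_iff.mpr ⟨hu, hx, hw, Or.inl ⟨hx', h⟩⟩)
      (not_between_of_adj huw hu hw x)

/-- Every pseudoline has a coordinate that increases from `u` to `v`. -/
theorem exists_coordinate_lt {u v : A.Vertex} (hu : A.On u i) (hv : A.On v i) (huv : u ≠ v) :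
    ∃ c, IsLineCoordinate (A.line i) c ∧ c u.1 < c v.1 := by
  obtain ⟨c, hc⟩ := (A.isPseudoline i).exists_coordinate
  rcases lt_trichotomy (c u.1) (c v.1) with h | h | h
  · exact ⟨c, hc, h⟩
  · exact absurd (Subtype.ext (hc.injOn hu hv h)) huv
  · exact ⟨_, hc.neg, neg_lt_neg h⟩

end Coordinate

/-! ### Shortest paths -/

theorem exists_shortest_on {i : Fin n} {u v : A.Vertex} (hu : A.On u i) (hv : A.On v i) :
    ∃ p : A.graph.Walk u v, p.length = A.graph.dist u v ∧ ∀ w ∈ p.support, A.On w i := by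
  by_cases huv : u = v
  · subst huv
    exact ⟨.nil, by simp, by simpa using hu⟩
  · obtain ⟨c, hc, hlt⟩ := exists_coordinate_lt hu hv huv
    obtain ⟨p, hp, hlen⟩ := exists_walk_on hc hu hv hlt
    refine ⟨p, le_antisymm ?_ (A.graph.dist_le p), hp⟩
    rwa [dist_eq hc hu hv hlt]

/-- A shortest walk between two vertices of the `i`-th pseudoline makes its first step along this
pseudoline: otherwise both pseudolines through its first vertex would be visited again by the rest
of the walk, which is too short for that. -/
theorem on_of_shortest_cons {i : Fin n} {u v w : A.Vertex} (hu : A.On u i) (hv : A.On v i)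
    (h : A.graph.Adj u w) (p : A.graph.Walk w v)
    (hp : (SimpleGraph.Walk.cons h p).length = A.graph.dist u v) : A.On w i := by
  by_contra hw
  have huv : u ≠ v := by
    rintro rfl
    simp at hp
  obtain ⟨c, hc, hlt⟩ := exists_coordinate_lt hu hv huv
  have h1 := ncard_between_add_three_le hc hu hv hlt (.cons h p)
  rw [dist_eq hc hu hv hlt, SimpleGraph.Walk.length_cons] at hp
  obtain ⟨-, j, huj, hwj, -⟩ := id h
  have hij : i ≠ j := fun e => hw (e ▸ hwj)
  obtain ⟨k, -, -, hk⟩ := exists_other huj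
  have hki : k = i := (((hk i).mp hu).resolve_left hij).symm
  rw [linesOf_cons h p hwj hk, hki, Set.insert_eq_of_mem (on_end_mem_linesOf p hv)] at h1
  have := ncard_linesOf_le p
  omega

theorem length_eq_dist_of_cons {u v w : A.Vertex} {h : A.graph.Adj u w} {p : A.graph.Walk w v}
    (hp : (SimpleGraph.Walk.cons h p).length = A.graph.dist u v) :
    p.length = A.graph.dist w v := by
  obtain ⟨q, hq⟩ := p.reachable.exists_walk_length_eq_dist
  have h1 := A.graph.dist_le (SimpleGraph.Walk.cons h q)
  have h2 := A.graph.dist_le p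
  simp only [SimpleGraph.Walk.length_cons] at hp h1
  omega

theorem shortest_unique {i : Fin n} {u v : A.Vertex} (hu : A.On u i) (hv : A.On v i)
    (p q : A.graph.Walk u v) (hp : p.length = A.graph.dist u v)
    (hq : q.length = A.graph.dist u v) : p = q := by
  induction p with
  | nil =>
    cases q with
    | nil => rfl
    | cons h q => simp at hq
  | @cons u w v h p ih =>
    cases q with
    | nil => simp at hp
    | @cons _ x _ h' q =>
      have hw := on_of_shortest_cons hu hv h p hp
      have hx := on_of_shortest_cons hu hv h' q hq
      have hp' := length_eq_dist_of_cons hp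
      have hq' := length_eq_dist_of_cons hq
      rw [SimpleGraph.Walk.length_cons] at hp hq
      have huv : u ≠ v := by
        rintro rfl
        simp at hp
      obtain ⟨c, hc, hlt⟩ := exists_coordinate_lt hu hv huv
      obtain rfl := first_step_unique hc hu hv hlt hw hx h h' (by omega) (by omega)
      rw [ih hw hv q hp' hq']

/-- A step from `u` to `w` along `j` at the start of a shortest walk adds a new pseudoline. If the
second pseudoline `k` through `u` contained a later vertex `x`, then the part of the walk
from `u` to `x` would begin along `k`. -/
theorem ncard_linesOf_of_shortest {u v : A.Vertex} (p : A.graph.Walk u v)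
    (hp : p.length = A.graph.dist u v) : (linesOf p).ncard = p.length + 2 := by
  classical
  induction p with
  | nil => exact ncard_linesOf_nil _
  | @cons u w v h p ih =>
    obtain ⟨hne, j, huj, hwj, -⟩ := id h
    obtain ⟨k, hkj, huk, hk⟩ := exists_other huj
    rw [linesOf_cons h p hwj hk, Set.ncard_insert_of_notMem, ih (length_eq_dist_of_cons hp),
      SimpleGraph.Walk.length_cons]
    rintro ⟨x, hx, hxk⟩
    have hpre : (SimpleGraph.Walk.cons h (p.takeUntil x hx)).length = A.graph.dist u x := by
      obtain ⟨q, hq⟩ :=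
        (SimpleGraph.Walk.cons h (p.takeUntil x hx)).reachable.exists_walk_length_eq_dist
      have h1 := A.graph.dist_le (q.append (p.dropUntil x hx))
      have h2 := A.graph.dist_le (SimpleGraph.Walk.cons h (p.takeUntil x hx))
      have h3 := congrArg SimpleGraph.Walk.length (p.take_spec hx)
      simp only [SimpleGraph.Walk.length_append, SimpleGraph.Walk.length_cons] at *
      omega
    have hwk := on_of_shortest_cons huk hxk h _ hpre
    exact hne (eq_of_on hkj huk huj hwk hwj)

/-! ### Connectedness, end vertices and diameter -/

theorem reachable (u v : A.Vertex) : A.graph.Reachable u v := by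
  obtain ⟨i, hi⟩ := exists_on u
  obtain ⟨j, hj⟩ := exists_on v
  have along : ∀ {x y : A.Vertex} {k : Fin n}, A.On x k → A.On y k → A.graph.Reachable x y :=
    fun hx hy => (exists_shortest_on hx hy).choose.reachable
  by_cases hij : i = j
  · exact along hi (hij ▸ hj)
  · obtain ⟨w, hwi, hwj⟩ := exists_vertex (A := A) hij
    exact (along hi hwi).trans (along hwj hj)

theorem dist_le_sub_two (u v : A.Vertex) : A.graph.dist u v ≤ n - 2 := by
  obtain ⟨p, hp⟩ := (reachable u v).exists_walk_length_eq_dist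
  have h1 := ncard_linesOf_of_shortest p hp
  have h2 := Set.ncard_le_card (linesOf p)
  rw [Nat.card_fin] at h2
  omega

/-- A pseudoline contains two different vertices, since it meets two others in different points. -/
theorem exists_ne_on (i : Fin n) : ∃ x y : A.Vertex, x ≠ y ∧ A.On x i ∧ A.On y i := by
  have hcard : 2 < (Finset.univ : Finset (Fin n)).card := by
    rw [Finset.card_univ, Fintype.card_fin]; exact A.three_le
  obtain ⟨j, hj⟩ := Finset.exists_mem_ne (s := Finset.univ) (by omega) i
  obtain ⟨k, -, hk⟩ : ∃ k ∈ Finset.univ, k ∉ ({i, j} : Finset (Fin n)) :=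
    Finset.exists_mem_notMem_of_card_lt_card ((Finset.card_le_two).trans_lt hcard)
  simp only [Finset.mem_insert, Finset.mem_singleton, not_or] at hk
  obtain ⟨x, hxi, hxj⟩ := exists_vertex (A := A) hj.2.symm
  obtain ⟨y, hyi, hyk⟩ := exists_vertex (A := A) (Ne.symm hk.1)
  refine ⟨x, y, ?_, hxi, hyi⟩
  rintro rfl
  obtain ⟨m, -, -, hm⟩ := exists_other hxi
  have h1 := ((hm j).mp hxj).resolve_left hj.2
  have h2 := ((hm k).mp hyk).resolve_left hk.1
  exact hk.2 (h2.trans h1.symm)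

/-- The end vertices are those of least and greatest coordinate. All pseudolines except the `i`-th
one and the two others through the end vertices cross it between them. -/
theorem exists_endVertices (i : Fin n) : ∃ u v : A.Vertex, u ≠ v ∧
    {w | A.IsEndVertex i w} = {u, v} ∧ A.graph.dist u v = n - 2 := by
  obtain ⟨c, hc⟩ := (A.isPseudoline i).exists_coordinate
  obtain ⟨x, y, hxy, hx, hy⟩ := exists_ne_on (A := A) i
  obtain ⟨u, hu, hmin⟩ := Set.exists_min_image {x : A.Vertex | A.On x i} (fun x => c x.1)
    (Set.toFinite _) ⟨x, hx⟩
  obtain ⟨v, hv, hmax⟩ := Set.exists_max_image {x : A.Vertex | A.On x i} (fun x => c x.1)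
    (Set.toFinite _) ⟨x, hx⟩
  simp only [Set.mem_ofPred_eq] at hu hv hmin hmax
  have huv : c u.1 < c v.1 := by
    by_contra! hle
    refine hxy (Subtype.ext (hc.injOn hx hy ?_))
    linarith [hmin x hx, hmin y hy, hmax x hx, hmax y hy]
  have hlt : ∀ w : A.Vertex, A.On w i → w ≠ u → c u.1 < c w.1 := fun w hw hwu =>
    lt_of_le_of_ne (hmin w hw) fun e => hwu (Subtype.ext (hc.injOn hw hu e.symm))
  have hgt : ∀ w : A.Vertex, A.On w i → w ≠ v → c w.1 < c v.1 := fun w hw hwv =>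
    lt_of_le_of_ne (hmax w hw) fun e => hwv (Subtype.ext (hc.injOn hw hv e))
  refine ⟨u, v, by rintro rfl; exact lt_irrefl _ huv, ?_, ?_⟩
  · ext w
    simp only [Set.mem_ofPred_eq, Set.mem_insert_iff, Set.mem_singleton_iff]
    constructor
    · rintro ⟨hw, hend⟩
      by_contra! hne
      exact hend u v hu hv (hc.strictlyBetween_iff.mpr
        ⟨hu, hw, hv, Or.inl ⟨hlt w hw hne.1, hgt w hw hne.2⟩⟩)
    · rintro (rfl | rfl)
      · refine ⟨hu, fun a b ha hb h => ?_⟩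
        rcases (hc.strictlyBetween_iff.mp h).2.2.2 with h | h
        · linarith [hmin a ha]
        · linarith [hmin b hb]
      · refine ⟨hv, fun a b ha hb h => ?_⟩
        rcases (hc.strictlyBetween_iff.mp h).2.2.2 with h | h
        · linarith [hmax b hb]
        · linarith [hmax a ha]
  · refine le_antisymm (dist_le_sub_two u v) ?_
    obtain ⟨a, hai, hua, -⟩ := exists_other hu
    obtain ⟨b, hbi, hvb, -⟩ := exists_other hv
    have hsub : (Set.univ : Set (Fin n)) ⊆
        insert i (insert a (insert b (A.between i c u v))) := by
      intro j _
      by_cases hji : j = i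
      · exact Or.inl hji
      obtain ⟨w, hwi, hwj⟩ := exists_vertex (A := A) (Ne.symm hji)
      by_cases hwu : w = u
      · subst hwu
        obtain ⟨m, -, -, hm⟩ := exists_other hwi
        exact Or.inr (Or.inl ((((hm j).mp hwj).resolve_left hji).trans
          (((hm a).mp hua).resolve_left hai).symm))
      by_cases hwv : w = v
      · subst hwv
        obtain ⟨m, -, -, hm⟩ := exists_other hwi
        exact Or.inr (Or.inr (Or.inl ((((hm j).mp hwj).resolve_left hji).trans
          (((hm b).mp hvb).resolve_left hbi).symm)))
      exact Or.inr (Or.inr (Or.inr ⟨hji, w, hwi, hwj, hlt w hwi hwu, hgt w hwi hwv⟩))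
    have h1 := Set.ncard_le_ncard hsub
    rw [Set.ncard_univ, Nat.card_fin] at h1
    have h2 := Set.ncard_insert_le i (insert a (insert b (A.between i c u v)))
    have h3 := Set.ncard_insert_le a (insert b (A.between i c u v))
    have h4 := Set.ncard_insert_le b (A.between i c u v)
    rw [dist_eq hc hu hv huv]
    omega

theorem connected : A.graph.Connected := by
  have h : 0 < n := lt_of_lt_of_le (by norm_num) A.three_le
  obtain ⟨x, -⟩ := exists_ne_on (A := A) ⟨0, h⟩
  exact { preconnected := reachable, nonempty := ⟨x⟩ }

theorem ediam_eq : A.graph.ediam = ((n - 2 : ℕ) : ℕ∞) := by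
  have hedist : ∀ u v : A.Vertex, A.graph.edist u v = (A.graph.dist u v : ℕ∞) := fun u v =>
    (ENat.natCast_toNat (SimpleGraph.edist_ne_top_iff_reachable.mpr (reachable u v))).symm
  refine le_antisymm ?_ ?_
  · refine SimpleGraph.ediam_le_of_edist_le fun u v => ?_
    rw [hedist]
    exact_mod_cast dist_le_sub_two u v
  · have h : 0 < n := lt_of_lt_of_le (by norm_num) A.three_le
    obtain ⟨u, v, -, -, hd⟩ := exists_endVertices (A := A) ⟨0, h⟩
    rw [← hd, ← hedist]
    exact SimpleGraph.edist_le_ediam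

end SimplePseudolineArrangement

theorem proposition1 (n : ℕ) (A : SimplePseudolineArrangement n) :
    -- the graph is connected and its diameter is `n - 2`
    (A.graph.Connected ∧ A.graph.ediam = ((n - 2 : ℕ) : ℕ∞)) ∧
    -- a shortest path of length `k` has vertices on exactly `k + 2` pseudolines
    (∀ (u v : A.Vertex) (p : A.graph.Walk u v), A.IsShortestPath p →
      {i : Fin n | ∃ w ∈ p.support, A.On w i}.ncard = p.length + 2) ∧
    -- the shortest path between two vertices of a pseudoline is unique and runs along it
    (∀ (i : Fin n) (u v : A.Vertex), A.On u i → A.On v i →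
      ∃ p : A.graph.Walk u v, A.IsShortestPath p ∧ (∀ w ∈ p.support, A.On w i) ∧
        ∀ q : A.graph.Walk u v, A.IsShortestPath q → q = p) ∧
    -- each pseudoline has exactly two end vertices, and their distance is `n - 2`
    (∀ i : Fin n, ∃ u v : A.Vertex, u ≠ v ∧ {w | A.IsEndVertex i w} = {u, v} ∧
      A.graph.dist u v = n - 2) := by
  refine ⟨⟨SimplePseudolineArrangement.connected, SimplePseudolineArrangement.ediam_eq⟩,
    fun u v p hp => SimplePseudolineArrangement.ncard_linesOf_of_shortest p hp.2,
    fun i u v hu hv => ?_, fun i => SimplePseudolineArrangement.exists_endVertices i⟩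
  obtain ⟨p, hp, hpi⟩ := SimplePseudolineArrangement.exists_shortest_on hu hv
  exact ⟨p, ⟨p.isPath_of_length_eq_dist hp, hp⟩, hpi, fun q hq =>
    SimplePseudolineArrangement.shortest_unique hu hv q p hq.2 hp⟩
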